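/- Let $n=2d+1>3$ and let $Q_n$ be the complex Lie algebra with basis $x_0,\dots,x_n$ and brackets $[x_0,x_i]=x_{i+1}$, $[x_i,x_{n-i}]=(-1)^i x_n$ for $1\le i\le n-1$, all other brackets being zero or obtained by antisymmetry. For a complex Lie algebra $N$ put $c^0N=N$, $c^iN=[N,c^{i-1}N]$. Call $N$ a quasi $Q_n$-filiform Lie algebra, denoted $N(Q_n,m,r)$, if $N=C_1+\cdots+C_m$ (a sum of vector spaces, not necessarily direct) with subalgebras $C_i\cong Q_n$ such that $[C_i,C_j]=0$ for $i\ne j$, and $r=\dim c^{n-1}N$. A $Q_n$-filiform decomposition of $N=N(Q_n,m,r)$ is a decomposition $$N=N_1+\cdots+N_q$$ as a sum of subalgebras such that each $N_i$ is a quasi $Q_n$-filiform Lie algebra $N_i(Q_n,m_i,1)$, $N_i\cap N_j=0$ and $[N_i,N_j]=0$ for $i\ne j$, and $\sum_{i=1}^q m_i=m$. **Proposition 2.1.** Every $N=N(Q_n,m,r)$ has a $Q_n$-filiform decomposition, and it is unique up to isomorphism: if $N=N_1+\cdots+N_q$ and $N=N'_1+\cdots+N'_{q'}$ are $Q_n$-filiform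 decompositions with $N_i=N_i(Q_n,m_i,1)$ and $N'_j=N'_j(Q_n,m'_j,1)$, then there are a bijection $\sigma:\{1,\dots,q\}\to\{1,\dots,q'\}$ (so $q=q'$) and an automorphism $\theta$ of the Lie algebra $N$ such that $\theta(N_i)=N'_{\sigma(i)}$ and $m'_{\sigma(i)}=m_i$ for all $i$. -/

import Mathlib

/-- The underlying space of the complex Lie algebra `Q_n`, `n = 2 * d + 1`: coordinate vectors
`(a_0, ..., a_n)` in the basis `x_0, ..., x_n`. -/
def QFiliform (d : ℕ) : Type := Fin (2 * d + 2) → ℂ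

namespace QFiliform

instance (d : ℕ) : AddCommGroup (QFiliform d) :=
  inferInstanceAs (AddCommGroup (Fin (2 * d + 2) → ℂ))

noncomputable instance (d : ℕ) : Module ℂ (QFiliform d) :=
  inferInstanceAs (Module ℂ (Fin (2 * d + 2) → ℂ))

/-- The `k`-th coordinate of `a`, with value `0` for `k > n = 2 * d + 1`. -/
noncomputable def coord {d : ℕ} (a : QFiliform d) (k : ℕ) : ℂ :=
  if h : k < 2 * d + 2 then a ⟨k, h⟩ else 0

/-- The basis vector `x_k` of `Q_n` (and `0` for `k > n = 2 * d + 1`). -/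
noncomputable def x (d : ℕ) (k : ℕ) : QFiliform d :=
  fun j => if (j : ℕ) = k then 1 else 0

/-- The coefficient `∑_{i=1}^{n-1} (-1)^i a_i b_{n-i}`, where `n = 2 * d + 1`. -/
noncomputable def form {d : ℕ} (a b : QFiliform d) : ℂ :=
  ∑ i ∈ Finset.range (2 * d), (-1) ^ (i + 1) * a.coord (i + 1) * b.coord (2 * d - i)

/-- The bracket of `Q_n`, `n = 2 * d + 1`: the bilinear extension of `[x_0, x_i] = x_{i+1}`,
`[x_i, x_0] = -x_{i+1}` and `[x_i, x_{n-i}] = (-1)^i x_n` for `1 ≤ i ≤ n - 1`, all other brackets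
of basis vectors being zero. -/
noncomputable instance (d : ℕ) : Bracket (QFiliform d) (QFiliform d) where
  bracket a b := fun k =>
    (if 2 ≤ (k : ℕ) then a.coord 0 * b.coord (k - 1) - b.coord 0 * a.coord (k - 1) else 0)
      + (if (k : ℕ) = 2 * d + 1 then form a b else 0)

variable {d : ℕ}

theorem ext_coord {a b : QFiliform d} (h : ∀ k < 2 * d + 2, a.coord k = b.coord k) : a = b := by
  funext k
  have := h k k.2
  simpa [coord] using this

@[simp] theorem coord_add (a b : QFiliform d) (k : ℕ) :
    (a + b).coord k = a.coord k + b.coord k := by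
  unfold coord
  split
  · rfl
  · simp

@[simp] theorem coord_smul (c : ℂ) (a : QFiliform d) (k : ℕ) :
    (c • a).coord k = c * a.coord k := by
  unfold coord
  split
  · rfl
  · simp

@[simp] theorem coord_zero (k : ℕ) : (0 : QFiliform d).coord k = 0 := by
  unfold coord
  split
  · rfl
  · rfl

theorem coord_x {j k : ℕ} (hk : k < 2 * d + 2) : (x d j).coord k = if k = j then 1 else 0 := by
  simp [coord, x, hk]

theorem coord_lie (a b : QFiliform d) {k : ℕ} (hk : k < 2 * d + 2) :
    ⁅a, b⁆.coord k =
      (if 2 ≤ k then a.coord 0 * b.coord (k - 1) - b.coord 0 * a.coord (k - 1) else 0)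
        + (if k = 2 * d + 1 then form a b else 0) := by
  rw [coord, dif_pos hk]
  rfl

theorem form_add_left (a b c : QFiliform d) : form (a + b) c = form a c + form b c := by
  simp only [form, coord_add, ← Finset.sum_add_distrib]
  exact Finset.sum_congr rfl fun i _ => by ring

theorem form_add_right (a b c : QFiliform d) : form a (b + c) = form a b + form a c := by
  simp only [form, coord_add, ← Finset.sum_add_distrib]
  exact Finset.sum_congr rfl fun i _ => by ring

theorem form_smul_right (t : ℂ) (a b : QFiliform d) : form a (t • b) = t * form a b := by
  simp only [form, coord_smul, Finset.mul_sum]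
  exact Finset.sum_congr rfl fun i _ => by ring

theorem form_swap (a b : QFiliform d) : form b a = - form a b := by
  unfold form
  rw [← Finset.sum_range_reflect, ← Finset.sum_neg_distrib]
  refine Finset.sum_congr rfl fun i hi => ?_
  have hi := Finset.mem_range.1 hi
  have e1 : 2 * d - 1 - i + 1 = 2 * d - i := by omega
  have e2 : 2 * d - (2 * d - 1 - i) = i + 1 := by omega
  have e3 : (-1 : ℂ) ^ (2 * d - i) = (-1) ^ i := by
    rcases Nat.even_or_odd i with h | h
    · rw [h.neg_one_pow, Even.neg_one_pow]
      exact (Nat.even_sub hi.le).2 (by simp [h])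
    · rw [h.neg_one_pow, Odd.neg_one_pow]
      exact Nat.Even.sub_odd hi.le (by simp) h
  rw [e1, e2, e3, pow_succ]
  ring

/-- The sum `∑_{i=1}^{n-2} (-1)^i a_i b_{n-1-i}`, used for the Jacobi identity. -/
noncomputable def form' (a b : QFiliform d) : ℂ :=
  ∑ i ∈ Finset.range (2 * d - 1), (-1) ^ (i + 1) * a.coord (i + 1) * b.coord (2 * d - 1 - i)

theorem form'_swap (a b : QFiliform d) : form' b a = form' a b := by
  unfold form'
  rw [← Finset.sum_range_reflect]
  refine Finset.sum_congr rfl fun i hi => ?_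
  have hi := Finset.mem_range.1 hi
  have e1 : 2 * d - 1 - 1 - i + 1 = 2 * d - 1 - i := by omega
  have e2 : 2 * d - 1 - (2 * d - 1 - 1 - i) = i + 1 := by omega
  have e3 : (-1 : ℂ) ^ (2 * d - 1 - i) = (-1) ^ (i + 1) := by
    have : 2 * d - 1 - i = 2 * d - (i + 1) := by omega
    rw [this]
    rcases Nat.even_or_odd (i + 1) with h | h
    · rw [h.neg_one_pow, Even.neg_one_pow]
      exact (Nat.even_sub (by omega)).2 (by simp [h])
    · rw [h.neg_one_pow, Odd.neg_one_pow]
      exact Nat.Even.sub_odd (by omega) (by simp) h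
  rw [e1, e2, e3]
  ring

theorem form_lie_right (a b c : QFiliform d) :
    form a ⁅b, c⁆ = b.coord 0 * form' a c - c.coord 0 * form' a b := by
  rcases Nat.eq_zero_or_pos d with rfl | hd
  · simp [form, form']
  obtain ⟨e, he⟩ : ∃ e, 2 * d = e + 1 := ⟨2 * d - 1, by omega⟩
  have e1 : 2 * d - 1 = e := by omega
  unfold form form'
  rw [e1, he, Finset.sum_range_succ, Finset.mul_sum, Finset.mul_sum, ← Finset.sum_sub_distrib,
    coord_lie b c (by omega), if_neg (by omega), if_neg (by omega), add_zero, mul_zero, add_zero]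
  refine Finset.sum_congr rfl fun i hi => ?_
  have hi := Finset.mem_range.1 hi
  have e2 : e + 1 - i - 1 = e - i := by omega
  rw [coord_lie b c (by omega), if_pos (by omega), if_neg (by omega), e2]
  ring

noncomputable instance (d : ℕ) : LieRing (QFiliform d) where
  add_lie a b c := by
    refine ext_coord fun k hk => ?_
    rw [coord_add, coord_lie _ _ hk, coord_lie _ _ hk, coord_lie _ _ hk, form_add_left]
    simp only [coord_add]
    split_ifs <;> ring
  lie_add a b c := by
    refine ext_coord fun k hk => ?_
    rw [coord_add, coord_lie _ _ hk, coord_lie _ _ hk, coord_lie _ _ hk, form_add_right]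
    simp only [coord_add]
    split_ifs <;> ring
  lie_self a := by
    refine ext_coord fun k hk => ?_
    have h : form a a = 0 := self_eq_neg.1 (form_swap a a)
    rw [coord_lie _ _ hk, h, coord_zero]
    simp
  leibniz_lie a b c := by
    refine ext_coord fun k hk => ?_
    have h0 : ∀ u v : QFiliform d, ⁅u, v⁆.coord 0 = 0 := fun u v => by
      rw [coord_lie _ _ (by omega), if_neg (by omega), if_neg (by omega), add_zero]
    rw [coord_add, coord_lie a _ hk, coord_lie _ c hk, coord_lie b _ hk, form_swap c ⁅a, b⁆,
      form_lie_right, form_lie_right, form_lie_right, form'_swap a b, form'_swap a c,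
      form'_swap b c, h0, h0, h0]
    by_cases h2 : 2 ≤ k
    · rw [coord_lie b c (by omega), coord_lie a b (by omega), coord_lie a c (by omega)]
      simp only [if_neg (show ¬ k - 1 = 2 * d + 1 by omega)]
      split_ifs <;> ring
    · simp only [if_neg h2]
      split_ifs <;> ring

noncomputable instance (d : ℕ) : LieAlgebra ℂ (QFiliform d) where
  lie_smul t a b := by
    refine ext_coord fun k hk => ?_
    rw [coord_smul, coord_lie _ _ hk, coord_lie _ _ hk, form_smul_right]
    simp only [coord_smul]
    split_ifs <;> ring

/-- `[x_0, x_i] = x_{i+1}` for `1 ≤ i ≤ n - 1`, and `[x_0, x_n] = 0`, where `n = 2 * d + 1`. -/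
theorem lie_x_zero {i : ℕ} (h1 : 1 ≤ i) : ⁅x d 0, x d i⁆ = x d (i + 1) := by
  refine ext_coord fun k hk => ?_
  have hf : form (x d 0) (x d i) = 0 := Finset.sum_eq_zero fun j hj => by
    have := Finset.mem_range.1 hj
    rw [coord_x (by omega), if_neg (by omega)]
    ring
  rw [coord_lie _ _ hk, hf, coord_x hk, coord_x (by omega), coord_x (by omega), coord_x (by omega),
    coord_x (by omega)]
  grind

/-- `[x_i, x_j] = (-1)^i x_n` if `i + j = n = 2 * d + 1`, and `[x_i, x_j] = 0` otherwise, for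
`1 ≤ i, j ≤ n`. -/
theorem lie_x_x {i j : ℕ} (hi : 1 ≤ i) (hj : 1 ≤ j) :
    ⁅x d i, x d j⁆ = if i + j = 2 * d + 1 then (-1 : ℂ) ^ i • x d (2 * d + 1) else 0 := by
  have hf : form (x d i) (x d j) = if i + j = 2 * d + 1 then (-1 : ℂ) ^ i else 0 := by
    unfold form
    split_ifs with h
    · rw [Finset.sum_eq_single (i - 1)]
      · rw [coord_x (by omega), coord_x (by omega), if_pos (by omega), if_pos (by omega),
          Nat.sub_add_cancel hi]
        ring
      · intro k hk hne
        have := Finset.mem_range.1 hk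
        rw [coord_x (by omega), if_neg (by omega)]
        ring
      · intro hk
        exact absurd (Finset.mem_range.2 (by omega)) hk
    · refine Finset.sum_eq_zero fun k hk => ?_
      have := Finset.mem_range.1 hk
      rw [coord_x (by omega), coord_x (by omega)]
      by_cases h3 : k + 1 = i
      · rw [if_neg (show ¬ 2 * d - k = j by omega)]
        ring
      · rw [if_neg h3]
        ring
  refine ext_coord fun k hk => ?_
  have h1 : (x d i).coord 0 = 0 := by rw [coord_x (by omega), if_neg (by omega)]
  have h2 : (x d j).coord 0 = 0 := by rw [coord_x (by omega), if_neg (by omega)]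
  rw [coord_lie _ _ hk, hf, h1, h2]
  by_cases h : i + j = 2 * d + 1
  · simp [h, coord_x hk]
  · simp [h]

end QFiliform

/-- `N` is a quasi `Q_n`-filiform Lie algebra `N(Q_n, m, r)`, `n = 2 * d + 1`: it is the (not
necessarily direct) sum of `m` pairwise commuting subalgebras isomorphic to `Q_n`, and
`r = dim c^{n-1} N`. -/
def IsQuasiQFiliform (d m r : ℕ) (N : Type*) [LieRing N] [LieAlgebra ℂ N] : Prop :=
  (∃ C : Fin m → LieSubalgebra ℂ N,
    (∀ i, Nonempty (C i ≃ₗ⁅ℂ⁆ QFiliform d)) ∧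
    (∀ i j, i ≠ j → ∀ a ∈ C i, ∀ b ∈ C j, ⁅a, b⁆ = 0) ∧
    ⨆ i, (C i).toSubmodule = ⊤) ∧
  Module.finrank ℂ (LieModule.lowerCentralSeries ℂ N N (2 * d)) = r

/-- The subalgebras `S i` form a `Q_n`-filiform decomposition `∑ i, N_i(Q_n, m_i, 1)` of
`N(Q_n, m, r)`, where `n = 2 * d + 1` and `m_i = mult i`. -/
structure IsQFiliformDecomposition (d m : ℕ) {N : Type*} [LieRing N] [LieAlgebra ℂ N]
    {q : ℕ} (mult : Fin q → ℕ) (S : Fin q → LieSubalgebra ℂ N) : Prop where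
  quasi : ∀ i, IsQuasiQFiliform d (mult i) 1 (S i)
  inter : ∀ i j, i ≠ j → S i ⊓ S j = ⊥
  comm : ∀ i j, i ≠ j → ∀ a ∈ S i, ∀ b ∈ S j, ⁅a, b⁆ = 0
  sum : ⨆ i, (S i).toSubmodule = ⊤
  sum_mult : ∑ i, mult i = m

/-! The centre of $Q_n$ is the line $\mathbb{C}x_n$. Bracketing a sum of elements of commuting
copies of $Q_n$ with one copy leaves only the component in that copy (`PairwiseCommute.sum_lie`). So
although the sum of the copies need not be direct, all relations between them are relations between
their central vectors $x_n$.

Existence: group the copies by the central line $\mathbb{C}x_n$ they define in $N$. A group has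
$r=1$ because $c^{n-1}$ is spanned by its central vectors (`IsCover.lowerCentralSeries_eq_span`). An
element common to two groups commutes with every copy, hence lies on two different lines and is
zero.

Uniqueness: for a central subspace $\ell$, the space $\{u : [u,N]\subseteq\ell\}$ exceeds the centre
in dimension by the number of copies whose $x_n$ lies in $\ell$ (`IsCover.finrank_transporter`).
That space depends only on $N$ and $\ell$, so the central lines and their multiplicities are
invariants of $N$. This matches the copies of two decompositions. Automorphisms of $Q_n$ rescale
$x_n$ by any nonzero factor, so matched copies may be given equal central vectors. The relations
then agree, and identifying the copies gives the automorphism (`IsCover.exists_lieEquiv`). -/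

namespace QFiliform

variable {d : ℕ}

/-! ### The centre, the index filtration and the dilations of $Q_n$ -/

instance : Module.Finite ℂ (QFiliform d) :=
  inferInstanceAs (Module.Finite ℂ (Fin (2 * d + 2) → ℂ))

theorem x_top_ne_zero : x d (2 * d + 1) ≠ 0 := fun h => by
  have := coord_x (d := d) (j := 2 * d + 1) (k := 2 * d + 1) (by omega)
  simp [h] at this

theorem coord_lie_x_zero (a : QFiliform d) {k : ℕ} (hk : 2 ≤ k) (hk' : k < 2 * d + 2) :
    ⁅a, x d 0⁆.coord k = -a.coord (k - 1) := by
  have hf : form a (x d 0) = 0 := Finset.sum_eq_zero fun j hj => by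
    have := Finset.mem_range.1 hj
    rw [coord_x (by omega), if_neg (by omega), mul_zero]
  rw [coord_lie _ _ hk', hf, coord_x (by omega), coord_x (by omega), if_pos hk,
    if_neg (by omega), if_pos rfl]
  simp

theorem coord_two_lie_x_one (hd : 2 ≤ d) (a : QFiliform d) :
    ⁅a, x d 1⁆.coord 2 = a.coord 0 := by
  rw [coord_lie _ _ (by omega), coord_x (by omega), coord_x (by omega), if_pos le_rfl,
    if_pos rfl, if_neg (by omega), if_neg (by omega)]
  simp

/-- The bracket raises the filtration by index: $x_0$ shifts indices by one, and the form only sees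
coordinates of index below $n$. -/
theorem coord_lie_of_lt {j : ℕ} (hj : 1 ≤ j) (a b : QFiliform d)
    (hb : ∀ i < j, b.coord i = 0) {k : ℕ} (hk : k ≤ j) : ⁅a, b⁆.coord k = 0 := by
  by_cases hk' : k < 2 * d + 2
  · have hf : k = 2 * d + 1 → form a b = 0 := fun h => Finset.sum_eq_zero fun i hi => by
      rw [hb _ (by omega), mul_zero]
    rw [coord_lie _ _ hk', hb 0 (by omega)]
    split_ifs with h1 h2 h2
    · rw [hb _ (by omega), hf h2]; ring
    · rw [hb _ (by omega)]; ring
    · rw [hf h2]; ring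
    · ring
  · rw [coord, dif_neg hk']

theorem coord_lie_zero (a b : QFiliform d) : ⁅a, b⁆.coord 0 = 0 := by
  rw [coord_lie _ _ (by omega), if_neg (by omega), if_neg (by omega), add_zero]

theorem coord_lie_one (hd : 2 ≤ d) (a b : QFiliform d) : ⁅a, b⁆.coord 1 = 0 := by
  rw [coord_lie _ _ (by omega), if_neg (by omega), if_neg (by omega), add_zero]

@[simp] theorem x_top_lie (b : QFiliform d) : ⁅x d (2 * d + 1), b⁆ = 0 := by
  rw [← lie_skew, neg_eq_zero]
  refine ext_coord fun k hk => ?_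
  rw [coord_zero]
  exact coord_lie_of_lt (j := 2 * d + 1) (by omega) _ _
    (fun i hi => by rw [coord_x (by omega), if_neg (by omega)]) (by omega)

theorem x_pred_lie (hd : 2 ≤ d) (b : QFiliform d) :
    ⁅x d (2 * d), b⁆ = (b.coord 1 - b.coord 0) • x d (2 * d + 1) := by
  refine ext_coord fun k hk => ?_
  have hf : form (x d (2 * d)) b = b.coord 1 := by
    unfold form
    rw [Finset.sum_eq_single (2 * d - 1)]
    · rw [show 2 * d - 1 + 1 = 2 * d by omega, show 2 * d - (2 * d - 1) = 1 by omega,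
        coord_x (by omega), if_pos rfl, Even.neg_one_pow (by simp)]
      ring
    · intro i hi hne
      have := Finset.mem_range.1 hi
      rw [coord_x (by omega), if_neg (by omega)]
      ring
    · intro h
      exact absurd (Finset.mem_range.2 (by omega)) h
  rw [coord_lie _ _ hk, hf, coord_smul, coord_x (by omega), coord_x (by omega), coord_x hk,
    if_neg (show ¬ 0 = 2 * d by omega)]
  by_cases h : k = 2 * d + 1
  · subst h
    rw [if_pos (by omega), if_pos (by omega)]
    simp
    ring
  · rw [if_neg (show ¬ k - 1 = 2 * d by omega)]
    simp [h]

theorem x_pred_lie_x_zero (hd : 2 ≤ d) : ⁅x d (2 * d), x d 0⁆ = -x d (2 * d + 1) := by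
  rw [x_pred_lie hd, coord_x (by omega), coord_x (by omega)]
  simp

/-- An element with vanishing coordinates of index `< 2 * d` is in the span of the last two basis
vectors. -/
theorem eq_of_coord_eq_zero {a : QFiliform d} (h : ∀ k < 2 * d, a.coord k = 0) :
    a = a.coord (2 * d) • x d (2 * d) + a.coord (2 * d + 1) • x d (2 * d + 1) := by
  refine ext_coord fun k hk => ?_
  rw [coord_add, coord_smul, coord_smul, coord_x hk, coord_x hk]
  rcases lt_trichotomy k (2 * d) with h1 | h1 | h1
  · rw [h k h1, if_neg (by omega), if_neg (by omega)]; ring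
  · subst h1; simp
  · obtain rfl : k = 2 * d + 1 := by omega
    simp

/-- Bracketing with $x_1$ exposes $a_0$ at index 2, and bracketing with $x_0$ exposes $-a_k$ at
index $k+1$. -/
theorem coord_eq_zero_of_coord_lie_eq_zero (hd : 2 ≤ d) {a : QFiliform d}
    {j : ℕ} (hj : 2 ≤ j) (hj' : j ≤ 2 * d + 1)
    (h : ∀ b : QFiliform d, ∀ k ≤ j, ⁅a, b⁆.coord k = 0) : ∀ k < j, a.coord k = 0 := by
  intro k hk
  rcases Nat.eq_zero_or_pos k with rfl | hk0
  · rw [← coord_two_lie_x_one hd a]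
    exact h _ _ hj
  · have h1 := coord_lie_x_zero a (k := k + 1) (by omega) (by omega)
    rw [h _ _ (by omega)] at h1
    simpa using h1.symm

theorem eq_smul_x_top_of_lie_eq_zero (hd : 2 ≤ d) {a : QFiliform d} (h : ∀ b : QFiliform d, ⁅a, b⁆ = 0) :
    a = a.coord (2 * d + 1) • x d (2 * d + 1) := by
  have h0 := coord_eq_zero_of_coord_lie_eq_zero hd (a := a) (j := 2 * d + 1) (by omega) le_rfl
    fun b k _ => by rw [h b, coord_zero]
  have h1 := eq_of_coord_eq_zero (a := a) fun k hk => h0 k (by omega)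
  rwa [h0 (2 * d) (by omega), zero_smul, zero_add] at h1

/-- The vector with coordinates `t a_0`, `t ^ k a_k` for `1 ≤ k ≤ n`. -/
noncomputable def dilate (t : ℂ) (a : QFiliform d) : QFiliform d :=
  fun k => t ^ max (k : ℕ) 1 * a.coord k

theorem coord_dilate (t : ℂ) (a : QFiliform d) {k : ℕ} (hk : k < 2 * d + 2) :
    (dilate t a).coord k = t ^ max k 1 * a.coord k := by
  conv_lhs => rw [coord, dif_pos hk]
  rfl

/-- The two indices in each term of the form add up to $n$. -/
theorem form_dilate (t : ℂ) (a b : QFiliform d) :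
    form (dilate t a) (dilate t b) = t ^ (2 * d + 1) * form a b := by
  unfold form
  rw [Finset.mul_sum]
  refine Finset.sum_congr rfl fun i hi => ?_
  have hi := Finset.mem_range.1 hi
  rw [coord_dilate _ _ (by omega), coord_dilate _ _ (by omega), max_eq_left (by omega),
    max_eq_left (by omega), show 2 * d + 1 = (i + 1) + (2 * d - i) by omega, pow_add]
  ring

/-- The diagonal endomorphism `x_0 ↦ t x_0`, `x_i ↦ t ^ i x_i` for `1 ≤ i ≤ n`. -/
noncomputable def dilation (d : ℕ) (t : ℂ) : QFiliform d →ₗ⁅ℂ⁆ QFiliform d where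
  toFun := dilate t
  map_add' a b := by
    refine ext_coord fun k hk => ?_
    rw [coord_dilate _ _ hk, coord_add, coord_add, coord_dilate _ _ hk, coord_dilate _ _ hk,
      mul_add]
  map_smul' c a := by
    refine ext_coord fun k hk => ?_
    rw [coord_dilate _ _ hk, coord_smul, coord_smul, coord_dilate _ _ hk, RingHom.id_apply]
    ring
  map_lie' {a b} := by
    refine ext_coord fun k hk => ?_
    change (dilate t ⁅a, b⁆).coord k = ⁅dilate t a, dilate t b⁆.coord k
    rw [coord_dilate _ _ hk, coord_lie _ _ hk, coord_lie _ _ hk, form_dilate,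
      coord_dilate _ _ (by omega), coord_dilate _ _ (by omega), coord_dilate _ _ (by omega),
      coord_dilate _ _ (by omega)]
    by_cases h2 : 2 ≤ k
    · have e : t ^ max k 1 = t * t ^ max (k - 1) 1 := by
        rw [← pow_succ']; congr 1; omega
      have e' : k = 2 * d + 1 → t ^ (2 * d + 1) = t * t ^ max (k - 1) 1 := fun h => by
        rw [← pow_succ']; congr 1; omega
      simp only [if_pos h2, e]
      split_ifs with h3
      · rw [e' h3, max_eq_right (Nat.zero_le 1), pow_one]; ring
      · rw [max_eq_right (Nat.zero_le 1), pow_one]; ring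
    · simp only [if_neg h2]
      split_ifs with h3
      · rw [h3, max_eq_left (by omega)]; ring
      · ring

theorem coord_dilation (t : ℂ) (a : QFiliform d) {k : ℕ} (hk : k < 2 * d + 2) :
    (dilation d t a).coord k = t ^ max k 1 * a.coord k :=
  coord_dilate t a hk

theorem dilation_dilation_inv {t : ℂ} (ht : t ≠ 0) (a : QFiliform d) :
    dilation d t (dilation d t⁻¹ a) = a := by
  refine ext_coord fun k hk => ?_
  rw [coord_dilation _ _ hk, coord_dilation _ _ hk, ← mul_assoc, ← mul_pow, mul_inv_cancel₀ ht,
    one_pow, one_mul]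

theorem dilation_injective {t : ℂ} (ht : t ≠ 0) : Function.Injective (dilation d t) := by
  refine Function.LeftInverse.injective (g := dilation d t⁻¹) fun a => ?_
  simpa using dilation_dilation_inv (inv_ne_zero ht) a

theorem dilation_x_top (t : ℂ) :
    dilation d t (x d (2 * d + 1)) = t ^ (2 * d + 1) • x d (2 * d + 1) := by
  refine ext_coord fun k hk => ?_
  rw [coord_dilation _ _ hk, coord_smul, coord_x hk]
  split_ifs with h
  · rw [h, max_eq_left (by omega)]
  · simp

theorem x_succ_mem_lowerCentralSeries (k : ℕ) :
    x d (k + 1) ∈ LieModule.lowerCentralSeries ℂ (QFiliform d) (QFiliform d) k := by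
  induction k with
  | zero => simp
  | succ k ih =>
    rw [LieModule.lowerCentralSeries_succ, ← lie_x_zero (d := d) (i := k + 1) (by omega)]
    exact LieSubmodule.lie_mem_lie (LieSubmodule.mem_top _) ih

end QFiliform

/-! ### Sums of commuting copies of $Q_n$ and their lower central series -/

namespace QFiliform

variable {d : ℕ} {N : Type*} [LieRing N] [LieAlgebra ℂ N] {P : Type*}

/-- The images of the homomorphisms `f p` commute pairwise. -/
def PairwiseCommute (f : P → QFiliform d →ₗ⁅ℂ⁆ N) : Prop :=
  ∀ p p', p ≠ p' → ∀ a b, ⁅f p a, f p' b⁆ = 0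

/-- `N` is the sum of pairwise commuting copies of `Q_n`, embedded by the homomorphisms `f p`. -/
structure IsCover (f : P → QFiliform d →ₗ⁅ℂ⁆ N) : Prop where
  injective : ∀ p, Function.Injective (f p)
  comm : PairwiseCommute f
  iSup_range : ⨆ p, (f p).range.toSubmodule = ⊤

theorem mem_iSup_range_iff [Fintype P] (f : P → QFiliform d →ₗ⁅ℂ⁆ N) {u : N} :
    u ∈ ⨆ p, (f p).range.toSubmodule ↔ ∃ a : P → QFiliform d, ∑ p, f p (a p) = u := by
  classical
  constructor
  · intro hu
    induction hu using Submodule.iSup_induction' with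
    | mem p u hu =>
      obtain ⟨b, rfl⟩ := hu
      refine ⟨Pi.single p b, ?_⟩
      rw [Finset.sum_eq_single p]
      · simp
      · intro q _ hq
        rw [Pi.single_eq_of_ne hq, map_zero]
      · simp
    | zero => exact ⟨0, by simp⟩
    | add u v _ _ hu hv =>
      obtain ⟨a, rfl⟩ := hu
      obtain ⟨b, rfl⟩ := hv
      exact ⟨a + b, by simp [Finset.sum_add_distrib]⟩
  · rintro ⟨a, rfl⟩
    exact Submodule.sum_mem _ fun p _ => Submodule.mem_iSup_of_mem p ⟨a p, rfl⟩

namespace PairwiseCommute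

variable {f : P → QFiliform d →ₗ⁅ℂ⁆ N}

/-- This recovers a component of an element, up to the centre of $Q_n$, even when the sum of the
copies is not direct. -/
theorem sum_lie [Fintype P] (hf : PairwiseCommute f) (a : P → QFiliform d) (q : P)
    (b : QFiliform d) : ⁅∑ p, f p (a p), f q b⁆ = f q ⁅a q, b⁆ := by
  rw [_root_.sum_lie, Finset.sum_eq_single q, LieHom.map_lie]
  · intro p _ hp
    exact hf p q hp _ _
  · simp

theorem sum_lie_sum [Fintype P] (hf : PairwiseCommute f) (a b : P → QFiliform d) :
    ⁅∑ p, f p (a p), ∑ p, f p (b p)⁆ = ∑ p, f p ⁅a p, b p⁆ := by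
  rw [lie_sum]
  exact Finset.sum_congr rfl fun p _ => hf.sum_lie a p (b p)

theorem comp {P' : Type*} (hf : PairwiseCommute f) {j : P' → P} (hj : Function.Injective j) :
    PairwiseCommute fun p => f (j p) :=
  fun _ _ h => hf _ _ (hj.ne h)

variable [Fintype P]

/-- The components of an element commuting with all the images are central. -/
theorem lie_eq_zero_of_sum_lie_eq_zero (hf : PairwiseCommute f)
    (hinj : ∀ p, Function.Injective (f p)) {a : P → QFiliform d}
    (h : ∀ p b, ⁅∑ p, f p (a p), f p b⁆ = 0) (p : P) (b : QFiliform d) : ⁅a p, b⁆ = 0 := by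
  refine hinj p ?_
  rw [map_zero, ← hf.sum_lie, h]

theorem sum_mem_span_of_lie_eq_zero (hf : PairwiseCommute f) (hd : 2 ≤ d)
    (hinj : ∀ p, Function.Injective (f p)) {a : P → QFiliform d}
    (h : ∀ p b, ⁅∑ p, f p (a p), f p b⁆ = 0) :
    ∑ p, f p (a p) ∈ Submodule.span ℂ (Set.range fun p => f p (x d (2 * d + 1))) := by
  refine Submodule.sum_mem _ fun p _ => ?_
  rw [eq_smul_x_top_of_lie_eq_zero hd (hf.lie_eq_zero_of_sum_lie_eq_zero hinj h p), map_smul]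
  exact Submodule.smul_mem _ _ (Submodule.subset_span ⟨p, rfl⟩)

/-- The sum of pairwise commuting images, as a Lie subalgebra. -/
noncomputable def sumRange (hf : PairwiseCommute f) : LieSubalgebra ℂ N where
  __ := ⨆ p, (f p).range.toSubmodule
  lie_mem' {u v} hu hv := by
    obtain ⟨a, rfl⟩ := (mem_iSup_range_iff f).1 hu
    obtain ⟨b, rfl⟩ := (mem_iSup_range_iff f).1 hv
    exact (mem_iSup_range_iff f).2 ⟨fun p => ⁅a p, b p⁆, (hf.sum_lie_sum a b).symm⟩

theorem mem_sumRange_iff (hf : PairwiseCommute f) {u : N} :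
    u ∈ hf.sumRange ↔ ∃ a : P → QFiliform d, ∑ p, f p (a p) = u :=
  mem_iSup_range_iff f

theorem apply_mem_sumRange (hf : PairwiseCommute f) (p : P) (a : QFiliform d) :
    f p a ∈ hf.sumRange :=
  Submodule.mem_iSup_of_mem (p := fun p => (f p).range.toSubmodule) p ⟨a, rfl⟩

/-- The homomorphism `f p` with values in the sum of all images. -/
noncomputable def toSumRange (hf : PairwiseCommute f) (p : P) : QFiliform d →ₗ⁅ℂ⁆ hf.sumRange where
  toFun a := ⟨f p a, hf.apply_mem_sumRange p a⟩
  map_add' a b := Subtype.ext (map_add (f p) a b)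
  map_smul' c a := Subtype.ext (map_smul (f p) c a)
  map_lie' {a b} := Subtype.ext (LieHom.map_lie (f p) a b)

theorem isCover_toSumRange (hf : PairwiseCommute f) (hinj : ∀ p, Function.Injective (f p)) :
    IsCover hf.toSumRange where
  injective p a b h := hinj p (congrArg Subtype.val h)
  comm p p' h a b := Subtype.ext (hf p p' h a b)
  iSup_range := by
    refine eq_top_iff.2 fun u _ => ?_
    obtain ⟨a, ha⟩ := hf.mem_sumRange_iff.1 u.2
    refine (mem_iSup_range_iff _).2 ⟨a, Subtype.ext ?_⟩
    rw [← ha, AddSubmonoidClass.coe_finsetSum]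
    rfl

end PairwiseCommute

namespace IsCover

variable {f : P → QFiliform d →ₗ⁅ℂ⁆ N}

theorem apply_x_top_ne_zero (hf : IsCover f) (p : P) : f p (x d (2 * d + 1)) ≠ 0 := fun h =>
  x_top_ne_zero (hf.injective p (h.trans (map_zero _).symm))

theorem apply_x_top_mem_lowerCentralSeries (p : P) :
    f p (x d (2 * d + 1)) ∈ LieModule.lowerCentralSeries ℂ N N (2 * d) :=
  LieIdeal.map_lowerCentralSeries_le (2 * d)
    (LieIdeal.mem_map (x_succ_mem_lowerCentralSeries (2 * d)))

theorem mem_span_of_finrank_eq_one (hf : IsCover f)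
    (h : Module.finrank ℂ (LieModule.lowerCentralSeries ℂ N N (2 * d)) = 1) (p q : P) :
    f p (x d (2 * d + 1)) ∈ Submodule.span ℂ {f q (x d (2 * d + 1))} := by
  have hne : (⟨_, apply_x_top_mem_lowerCentralSeries q⟩ :
      LieModule.lowerCentralSeries ℂ N N (2 * d)) ≠ 0 := fun h =>
    hf.apply_x_top_ne_zero q (congrArg Subtype.val h)
  obtain ⟨c, hc⟩ := (finrank_eq_one_iff_of_nonzero' _ hne).1 h
    ⟨_, apply_x_top_mem_lowerCentralSeries p⟩
  exact Submodule.mem_span_singleton.2 ⟨c, congrArg Subtype.val hc⟩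

variable [Fintype P]

theorem exists_sum_eq (hf : IsCover f) (u : N) : ∃ a : P → QFiliform d, ∑ p, f p (a p) = u :=
  (mem_iSup_range_iff f).1 (hf.iSup_range ▸ Submodule.mem_top)

theorem apply_x_top_lie (hf : IsCover f) (p : P) (u : N) :
    ⁅f p (x d (2 * d + 1)), u⁆ = 0 := by
  obtain ⟨a, rfl⟩ := hf.exists_sum_eq u
  rw [← lie_skew, hf.comm.sum_lie, ← lie_skew, x_top_lie, neg_zero, map_zero, neg_zero]

theorem finite (hf : IsCover f) : Module.Finite ℂ N := by
  have h : ∀ p, Module.Finite ℂ (f p).range.toSubmodule := fun p => by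
    rw [LieHom.range_toSubmodule]
    infer_instance
  have := Submodule.finite_iSup fun p => (f p).range.toSubmodule
  rw [hf.iSup_range] at this
  exact Module.finite_def.2 ((Submodule.fg_top _).1 (Module.finite_def.1 this))

/-- Brackets are computed componentwise. The first one kills the coordinates 0 and 1 together, and
each later one kills one more. -/
theorem exists_of_mem_lowerCentralSeries (hf : IsCover f) (hd : 2 ≤ d) (k : ℕ) :
    ∀ u ∈ LieModule.lowerCentralSeries ℂ N N (k + 1), ∃ a : P → QFiliform d,
      ∑ p, f p (a p) = u ∧ ∀ p, ∀ j ≤ k + 1, (a p).coord j = 0 := by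
  -- The vanishing condition is linear, so it suffices to check it on the brackets that span the
  -- next term.
  have span : ∀ s : Set N, ∀ k : ℕ, (∀ u ∈ s, ∃ a : P → QFiliform d,
      ∑ p, f p (a p) = u ∧ ∀ p, ∀ j ≤ k, (a p).coord j = 0) →
      ∀ u ∈ Submodule.span ℂ s, ∃ a : P → QFiliform d,
      ∑ p, f p (a p) = u ∧ ∀ p, ∀ j ≤ k, (a p).coord j = 0 := by
    intro s k hs u hu
    induction hu using Submodule.span_induction with
    | mem u hu => exact hs u hu
    | zero => exact ⟨0, by simp, by simp⟩
    | add u v _ _ hu hv =>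
      obtain ⟨a, rfl, ha⟩ := hu
      obtain ⟨b, rfl, hb⟩ := hv
      refine ⟨a + b, by simp [Finset.sum_add_distrib], fun p j hj => ?_⟩
      rw [Pi.add_apply, coord_add, ha p j hj, hb p j hj, add_zero]
    | smul c u _ hu =>
      obtain ⟨a, rfl, ha⟩ := hu
      refine ⟨c • a, by simp [Finset.smul_sum], fun p j hj => ?_⟩
      rw [Pi.smul_apply, coord_smul, ha p j hj, mul_zero]
  induction k with
  | zero =>
    intro u hu
    rw [LieModule.lowerCentralSeries_succ, ← LieSubmodule.mem_toSubmodule,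
      LieSubmodule.lieIdeal_oper_eq_linear_span'] at hu
    refine span _ _ ?_ u hu
    rintro _ ⟨v, -, w, -, rfl⟩
    obtain ⟨a, rfl⟩ := hf.exists_sum_eq v
    obtain ⟨b, rfl⟩ := hf.exists_sum_eq w
    refine ⟨fun p => ⁅a p, b p⁆, (hf.comm.sum_lie_sum a b).symm, fun p j hj => ?_⟩
    interval_cases j
    · exact coord_lie_zero _ _
    · exact coord_lie_one hd _ _
  | succ k ih =>
    intro u hu
    rw [LieModule.lowerCentralSeries_succ, ← LieSubmodule.mem_toSubmodule,
      LieSubmodule.lieIdeal_oper_eq_linear_span'] at hu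
    refine span _ _ ?_ u hu
    rintro _ ⟨v, -, w, hw, rfl⟩
    obtain ⟨a, rfl⟩ := hf.exists_sum_eq v
    obtain ⟨b, rfl, hb⟩ := ih w hw
    exact ⟨fun p => ⁅a p, b p⁆, (hf.comm.sum_lie_sum a b).symm, fun p j hj =>
      coord_lie_of_lt (by omega) _ _ (fun i hi => hb p i (by omega)) hj⟩

/-- After $n-1=2d$ steps only the coordinate of index $n$ can survive. -/
theorem lowerCentralSeries_eq_span (hf : IsCover f) (hd : 2 ≤ d) :
    (LieModule.lowerCentralSeries ℂ N N (2 * d)).toSubmodule =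
      Submodule.span ℂ (Set.range fun p => f p (x d (2 * d + 1))) := by
  apply le_antisymm
  · intro u hu
    obtain ⟨k, hk⟩ : ∃ k, 2 * d = k + 1 := ⟨2 * d - 1, by omega⟩
    rw [hk] at hu
    obtain ⟨a, rfl, ha⟩ := hf.exists_of_mem_lowerCentralSeries hd k u hu
    refine Submodule.sum_mem _ fun p _ => ?_
    have e := eq_of_coord_eq_zero (a := a p) fun j hj => ha p j (by omega)
    rw [ha p (2 * d) (by omega), zero_smul, zero_add] at e
    rw [e, map_smul]
    exact Submodule.smul_mem _ _ (Submodule.subset_span ⟨p, rfl⟩)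
  · rw [Submodule.span_le]
    rintro _ ⟨p, rfl⟩
    exact apply_x_top_mem_lowerCentralSeries p

theorem finrank_lowerCentralSeries_eq_one (hf : IsCover f) (hd : 2 ≤ d) (q : P)
    (h : ∀ p, f p (x d (2 * d + 1)) ∈ Submodule.span ℂ {f q (x d (2 * d + 1))}) :
    Module.finrank ℂ (LieModule.lowerCentralSeries ℂ N N (2 * d)) = 1 := by
  have e : (LieModule.lowerCentralSeries ℂ N N (2 * d)).toSubmodule =
      Submodule.span ℂ {f q (x d (2 * d + 1))} := by
    rw [hf.lowerCentralSeries_eq_span hd]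
    apply le_antisymm
    · rw [Submodule.span_le]
      rintro _ ⟨p, rfl⟩
      exact h p
    · exact Submodule.span_mono (Set.singleton_subset_iff.2 ⟨q, rfl⟩)
  change Module.finrank ℂ (LieModule.lowerCentralSeries ℂ N N (2 * d)).toSubmodule = 1
  rw [e]
  exact finrank_span_singleton (hf.apply_x_top_ne_zero q)

theorem isQuasiQFiliform (hf : IsCover f) {m r : ℕ} (hm : Fintype.card P = m)
    (hr : Module.finrank ℂ (LieModule.lowerCentralSeries ℂ N N (2 * d)) = r) :
    IsQuasiQFiliform d m r N := by
  refine ⟨⟨fun i => (f ((Fintype.equivFinOfCardEq hm).symm i)).range, fun i => ?_, ?_, ?_⟩, hr⟩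
  · exact ⟨(LieEquiv.ofInjective _ (hf.injective _)).symm⟩
  · rintro i j hij _ ⟨a, rfl⟩ _ ⟨b, rfl⟩
    exact hf.comm _ _ ((Fintype.equivFinOfCardEq hm).symm.injective.ne hij) _ _
  · rw [← hf.iSup_range]
    exact (Fintype.equivFinOfCardEq hm).symm.iSup_comp
      (g := fun p => (f p).range.toSubmodule)

end IsCover

theorem exists_isCover_of_isQuasiQFiliform {m r : ℕ} (h : IsQuasiQFiliform d m r N) :
    ∃ f : Fin m → QFiliform d →ₗ⁅ℂ⁆ N, IsCover f := by
  obtain ⟨⟨C, hC, hcomm, hsup⟩, -⟩ := h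
  let e := fun i => (hC i).some
  refine ⟨fun i => (C i).incl.comp (e i).symm.toLieHom, fun i => ?_, fun i j hij a b => ?_, ?_⟩
  · exact Subtype.val_injective.comp (e i).symm.injective
  · exact hcomm i j hij _ ((e i).symm a).2 _ ((e j).symm b).2
  · rw [← hsup]
    congr 1
    funext i
    ext u
    constructor
    · rintro ⟨a, rfl⟩
      exact ((e i).symm a).2
    · intro hu
      exact ⟨e i ⟨u, hu⟩, congrArg Subtype.val ((e i).symm_apply_apply ⟨u, hu⟩)⟩

end QFiliform

/-! ### Central lines and existence of a decomposition -/

namespace QFiliform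

variable {d : ℕ} {N : Type*} [LieRing N] [LieAlgebra ℂ N] {P : Type*}

theorem span_singleton_eq_of_mem {u v : N} (hu : u ≠ 0) (h : u ∈ Submodule.span ℂ {v}) :
    Submodule.span ℂ {u} = Submodule.span ℂ {v} := by
  obtain ⟨c, rfl⟩ := Submodule.mem_span_singleton.1 h
  have hc : c ≠ 0 := fun h => hu (by rw [h, zero_smul])
  exact Submodule.span_singleton_smul_eq (IsUnit.mk0 c hc) v

/-- The central line `ℂ x_n` of the copy of `Q_n` embedded by `f p`. -/
noncomputable def centralLine (f : P → QFiliform d →ₗ⁅ℂ⁆ N) (p : P) : Submodule ℂ N :=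
  Submodule.span ℂ {f p (x d (2 * d + 1))}

theorem apply_x_top_mem_centralLine (f : P → QFiliform d →ₗ⁅ℂ⁆ N) (p : P) :
    f p (x d (2 * d + 1)) ∈ centralLine f p :=
  Submodule.mem_span_singleton_self _

theorem IsCover.mem_centralLine_iff {f : P → QFiliform d →ₗ⁅ℂ⁆ N} (hf : IsCover f) (p q : P) :
    f p (x d (2 * d + 1)) ∈ centralLine f q ↔ centralLine f p = centralLine f q :=
  ⟨fun h => span_singleton_eq_of_mem (hf.apply_x_top_ne_zero p) h,
    fun h => h ▸ apply_x_top_mem_centralLine f p⟩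

/-- The copies of `Q_n` with a given central line generate the pieces of a decomposition. -/
theorem exists_isQFiliformDecomposition (hd : 2 ≤ d) {m r : ℕ} (hN : IsQuasiQFiliform d m r N) :
    ∃ (q : ℕ) (mult : Fin q → ℕ) (S : Fin q → LieSubalgebra ℂ N),
      IsQFiliformDecomposition d m mult S := by
  classical
  obtain ⟨f, hf⟩ := exists_isCover_of_isQuasiQFiliform hN
  -- Number the distinct central lines; `ρ` sends a copy to the number of its line.
  obtain ⟨q, ρ, hρ, hker⟩ : ∃ (q : ℕ) (ρ : Fin m → Fin q), Function.Surjective ρ ∧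
      ∀ i j, ρ i = ρ j ↔ centralLine f i = centralLine f j := by
    let e := Finite.equivFin (Set.range (centralLine f))
    refine ⟨_, e ∘ Set.rangeFactorization (centralLine f),
      e.surjective.comp Set.rangeFactorization_surjective, fun i j => ?_⟩
    rw [Function.comp_apply, Function.comp_apply, e.apply_eq_iff_eq, Subtype.ext_iff]
    rfl
  have hc : ∀ t : Fin q, PairwiseCommute fun p : {i // ρ i = t} => f p :=
    fun t => hf.comm.comp Subtype.val_injective
  have hlie : ∀ t i, ρ i ≠ t → ∀ u ∈ (hc t).sumRange, ∀ b, ⁅u, f i b⁆ = 0 := by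
    intro t i hi u hu b
    obtain ⟨a, rfl⟩ := (hc t).mem_sumRange_iff.1 hu
    rw [sum_lie]
    exact Finset.sum_eq_zero fun p _ => hf.comm p i (fun h => hi (h ▸ p.2)) _ _
  -- A central element of a group is a combination of the group's central vectors, which all lie on
  -- one line.
  have hline : ∀ t i, ρ i = t → ∀ u ∈ (hc t).sumRange, (∀ p b, ⁅u, f p b⁆ = 0) →
      u ∈ centralLine f i := by
    intro t i hi u hu h
    obtain ⟨a, rfl⟩ := (hc t).mem_sumRange_iff.1 hu
    refine Submodule.span_le.2 ?_
      ((hc t).sum_mem_span_of_lie_eq_zero hd (fun p => hf.injective p) fun p b => h p b)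
    rintro _ ⟨p, rfl⟩
    exact (hf.mem_centralLine_iff _ _).2 ((hker _ _).1 (p.2.trans hi.symm))
  refine ⟨q, fun t => Fintype.card {i // ρ i = t}, fun t => (hc t).sumRange,
    fun t => ?_, fun t t' htt => ?_, fun t t' htt u hu v hv => ?_, ?_, ?_⟩
  · have hcov := (hc t).isCover_toSumRange fun p => hf.injective p
    obtain ⟨i, hi⟩ := hρ t
    refine hcov.isQuasiQFiliform rfl
      (hcov.finrank_lowerCentralSeries_eq_one hd ⟨i, hi⟩ fun p => ?_)
    obtain ⟨c, hc⟩ := Submodule.mem_span_singleton.1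
      ((hf.mem_centralLine_iff p i).2 ((hker _ _).1 (p.2.trans hi.symm)))
    exact Submodule.mem_span_singleton.2 ⟨c, Subtype.ext hc⟩
  · refine (LieSubalgebra.eq_bot_iff _).2 fun u hu => ?_
    obtain ⟨hu, hu'⟩ := (LieSubalgebra.mem_inf _ _ _).1 hu
    -- Every copy lies outside at least one of the two groups, and `u` belongs to both.
    have h : ∀ p b, ⁅u, f p b⁆ = 0 := fun p b => by
      by_cases hp : ρ p = t
      · exact hlie t' p (fun h => htt (hp.symm.trans h)) u hu' b
      · exact hlie t p hp u hu b
    obtain ⟨i, hi⟩ := hρ t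
    obtain ⟨j, hj⟩ := hρ t'
    by_contra hne
    refine htt (hi.symm.trans (((hker i j).2 ?_).trans hj))
    exact (span_singleton_eq_of_mem hne (hline t i hi u hu h)).symm.trans
      (span_singleton_eq_of_mem hne (hline t' j hj u hu' h))
  · obtain ⟨b, rfl⟩ := (hc t').mem_sumRange_iff.1 hv
    rw [lie_sum]
    exact Finset.sum_eq_zero fun p _ => hlie t p (fun h => htt (h.symm.trans p.2)) u hu _
  · refine top_unique (hf.iSup_range.symm.le.trans (iSup_le fun p => ?_))
    refine le_iSup_of_le (ρ p) ?_
    rintro _ ⟨a, rfl⟩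
    exact (hc (ρ p)).apply_mem_sumRange ⟨p, rfl⟩ a
  · rw [← Fintype.card_sigma, Fintype.card_congr (Equiv.sigmaFiberEquiv ρ), Fintype.card_fin]

end QFiliform

/-! ### Counting copies by transporters, and conjugacy of covers -/

namespace QFiliform

variable {d : ℕ} {N : Type*} [LieRing N] [LieAlgebra ℂ N] {P : Type*}

/-- The elements `u` with `[u, N] ⊆ ℓ`. -/
def transporter (ℓ : Submodule ℂ N) : Submodule ℂ N where
  carrier := {u | ∀ v, ⁅u, v⁆ ∈ ℓ}
  add_mem' hu hv w := by
    rw [add_lie]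
    exact ℓ.add_mem (hu w) (hv w)
  zero_mem' w := by
    rw [zero_lie]
    exact ℓ.zero_mem
  smul_mem' c u hu w := by
    rw [smul_lie]
    exact ℓ.smul_mem c (hu w)

namespace IsCover

variable [Fintype P] {f : P → QFiliform d →ₗ⁅ℂ⁆ N}

theorem apply_mem_transporter (hf : IsCover f) {ℓ : Submodule ℂ N} {p : P} {a : QFiliform d}
    (h : ∀ b, f p ⁅a, b⁆ ∈ ℓ) : f p a ∈ transporter ℓ := by
  intro v
  obtain ⟨b, rfl⟩ := hf.exists_sum_eq v
  rw [← lie_skew, hf.comm.sum_lie, ← lie_skew, map_neg, neg_neg]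
  exact h _

theorem apply_x_pred_mem_transporter (hf : IsCover f) (hd : 2 ≤ d) {ℓ : Submodule ℂ N} {p : P}
    (h : f p (x d (2 * d + 1)) ∈ ℓ) : f p (x d (2 * d)) ∈ transporter ℓ :=
  hf.apply_mem_transporter fun b => by
    rw [x_pred_lie hd, map_smul]
    exact ℓ.smul_mem _ h

theorem apply_x_top_mem_transporter (hf : IsCover f) (ℓ : Submodule ℂ N) (p : P) :
    f p (x d (2 * d + 1)) ∈ transporter ℓ := fun v => by
  rw [hf.apply_x_top_lie]
  exact ℓ.zero_mem

/-- If `[u, N]` is in a central subspace `ℓ`, then each component of `u` is in the span of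
`x_{n-1}` and `x_n`, and in that of `x_n` unless the central line of its index is in `ℓ`. -/
theorem exists_component_eq (hf : IsCover f) (hd : 2 ≤ d) {ℓ : Submodule ℂ N}
    (hℓ : ℓ ≤ transporter ⊥) {a : P → QFiliform d} (ha : ∑ p, f p (a p) ∈ transporter ℓ)
    (p : P) : ∃ s t : ℂ, a p = s • x d (2 * d) + t • x d (2 * d + 1) ∧
      (s = 0 ∨ f p (x d (2 * d + 1)) ∈ ℓ) := by
  have h : ∀ b, f p ⁅a p, b⁆ ∈ ℓ := fun b => by
    rw [← hf.comm.sum_lie]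
    exact ha _
  -- As `ℓ` is central in $N$ and `f p` is injective, $[a_p,b]$ is central in $Q_n$.
  have hcentral : ∀ b : QFiliform d, ∀ k ≤ 2 * d, ⁅a p, b⁆.coord k = 0 := fun b k hk => by
    have h2 : ∀ c : QFiliform d, ⁅⁅a p, b⁆, c⁆ = 0 := fun c => by
      refine hf.injective p ?_
      rw [map_zero, LieHom.map_lie]
      exact hℓ (h b) _
    rw [eq_smul_x_top_of_lie_eq_zero hd h2, coord_smul, coord_x (by omega), if_neg (by omega),
      mul_zero]
  have e := eq_of_coord_eq_zero
    (coord_eq_zero_of_coord_lie_eq_zero hd (j := 2 * d) (by omega) (by omega) hcentral)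
  refine ⟨_, _, e, or_iff_not_imp_left.2 fun hs => ?_⟩
  -- Bracketing with $x_0$ turns $s x_{n-1}$ into $-s x_n$, whose image must lie in `ℓ`.
  have h0 := h (x d 0)
  rw [e, add_lie, smul_lie, smul_lie, x_top_lie, smul_zero, add_zero, x_pred_lie_x_zero hd,
    map_smul, map_neg] at h0
  simpa using (ℓ.smul_mem_iff hs).1 h0

/-- The transporter of $0$ is the centre. A basis of a complement to it in the transporter of `ℓ` is
given by the vectors $x_{n-1}$ of the copies with $x_n$ in `ℓ`. -/
theorem finrank_transporter (hf : IsCover f) (hd : 2 ≤ d) {ℓ : Submodule ℂ N}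
    (hℓ : ℓ ≤ transporter ⊥) :
    Module.finrank ℂ (transporter ℓ) = Module.finrank ℂ (transporter (⊥ : Submodule ℂ N)) +
      Nat.card {p // f p (x d (2 * d + 1)) ∈ ℓ} := by
  classical
  have := hf.finite
  let G := Fintype.linearCombination ℂ
    fun p : {p // f p (x d (2 * d + 1)) ∈ ℓ} => f p (x d (2 * d))
  -- The bracket with $x_0$ of the copy `s` isolates the coefficient `t s`.
  have hG : ∀ t, G t ∈ transporter (⊥ : Submodule ℂ N) → t = 0 := by
    intro t ht
    funext s
    have hc : PairwiseCommute fun p : {p // f p (x d (2 * d + 1)) ∈ ℓ} => f p :=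
      hf.comm.comp Subtype.val_injective
    have e : G t = ∑ p, f p.1 (t p • x d (2 * d)) := by
      simp [G, Fintype.linearCombination_apply]
    have h0 := (Submodule.mem_bot ℂ).1 (ht (f s (x d 0)))
    rw [e, hc.sum_lie (fun p => t p • x d (2 * d)), smul_lie, x_pred_lie_x_zero hd, smul_neg,
      map_neg, neg_eq_zero, map_smul] at h0
    exact (smul_eq_zero.1 h0).resolve_right (hf.apply_x_top_ne_zero s)
  have hinj : Function.Injective G := by
    rw [← LinearMap.ker_eq_bot, LinearMap.ker_eq_bot']
    exact fun t ht => hG t (ht ▸ Submodule.zero_mem _)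
  have hinf : LinearMap.range G ⊓ transporter (⊥ : Submodule ℂ N) = ⊥ := by
    refine (Submodule.eq_bot_iff _).2 ?_
    rintro _ ⟨⟨t, rfl⟩, ht⟩
    rw [hG t ht, map_zero]
  have hsup : LinearMap.range G ⊔ transporter (⊥ : Submodule ℂ N) = transporter ℓ := by
    apply le_antisymm
    · refine sup_le ?_ fun u hu v => ?_
      · rintro _ ⟨t, rfl⟩
        rw [Fintype.linearCombination_apply]
        exact Submodule.sum_mem _ fun p _ =>
          Submodule.smul_mem _ _ (hf.apply_x_pred_mem_transporter hd p.2)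
      · rw [(Submodule.mem_bot ℂ).1 (hu v)]
        exact ℓ.zero_mem
    · intro u hu
      obtain ⟨a, rfl⟩ := hf.exists_sum_eq u
      refine Submodule.sum_mem _ fun p _ => ?_
      obtain ⟨s, t, e, hs⟩ := hf.exists_component_eq hd hℓ hu p
      rw [e, map_add, map_smul, map_smul]
      refine Submodule.add_mem _ ?_ (Submodule.mem_sup_right
        (Submodule.smul_mem _ _ (hf.apply_x_top_mem_transporter _ p)))
      rcases hs with rfl | hs
      · rw [zero_smul]
        exact Submodule.zero_mem _
      · refine Submodule.mem_sup_left ⟨Pi.single ⟨p, hs⟩ s, ?_⟩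
        exact Fintype.linearCombination_apply_single ℂ _ _ s
  have hdim := Submodule.finrank_sup_add_finrank_inf_eq (LinearMap.range G)
    (transporter (⊥ : Submodule ℂ N))
  rw [hinf, hsup, finrank_bot, add_zero, LinearMap.finrank_range_of_inj hinj,
    Module.finrank_fintype_fun_eq_card, ← Nat.card_eq_fintype_card] at hdim
  rw [hdim, add_comm]

/-- Two covers by copies of `Q_n` with the same central vectors are conjugate. -/
theorem exists_lieEquiv {g : P → QFiliform d →ₗ⁅ℂ⁆ N} (hf : IsCover f) (hg : IsCover g)
    (hd : 2 ≤ d) (h : ∀ p, f p (x d (2 * d + 1)) = g p (x d (2 * d + 1))) :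
    ∃ θ : N ≃ₗ⁅ℂ⁆ N, ∀ p a, θ (f p a) = g p a := by
  classical
  -- Two representations of one element differ by multiples of $x_n$ in each component, and there
  -- `f` and `g` agree.
  have key : ∀ {f g : P → QFiliform d →ₗ⁅ℂ⁆ N}, IsCover f →
      (∀ p, f p (x d (2 * d + 1)) = g p (x d (2 * d + 1))) →
      ∀ a b : P → QFiliform d, ∑ p, f p (a p) = ∑ p, f p (b p) →
      ∑ p, g p (a p) = ∑ p, g p (b p) := by
    intro f g hf h a b hab
    rw [← sub_eq_zero, ← Finset.sum_sub_distrib] at hab ⊢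
    simp only [← map_sub] at hab ⊢
    have hc := hf.comm.lie_eq_zero_of_sum_lie_eq_zero hf.injective
      (a := fun p => a p - b p) fun p c => by rw [hab, zero_lie]
    rw [← hab]
    refine Finset.sum_congr rfl fun p _ => ?_
    rw [eq_smul_x_top_of_lie_eq_zero hd (hc p), map_smul, map_smul, h]
  -- The components are chosen arbitrarily; by `key` the value of `θ` does not depend on the choice,
  -- which makes it a homomorphism.
  choose s hs using hf.exists_sum_eq
  choose t ht using hg.exists_sum_eq
  have hθ : ∀ a : P → QFiliform d, ∑ p, g p (s (∑ p, f p (a p)) p) = ∑ p, g p (a p) :=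
    fun a => key hf h _ _ (hs _)
  have hη : ∀ a : P → QFiliform d, ∑ p, f p (t (∑ p, g p (a p)) p) = ∑ p, f p (a p) :=
    fun a => key hg (fun p => (h p).symm) _ _ (ht _)
  refine ⟨{ toFun := fun u => ∑ p, g p (s u p)
            map_add' := fun u v => ?_
            map_smul' := fun c u => ?_
            map_lie' := fun {u v} => ?_
            invFun := fun u => ∑ p, f p (t u p)
            left_inv := fun u => ?_
            right_inv := fun u => ?_ }, fun p a => ?_⟩
  · have := hθ (s u + s v)
    simpa [Finset.sum_add_distrib, hs] using this
  · have := hθ (c • s u)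
    simpa [← Finset.smul_sum, hs] using this
  · have := hθ fun p => ⁅s u p, s v p⁆
    rw [← hf.comm.sum_lie_sum, ← hg.comm.sum_lie_sum, hs, hs] at this
    exact this
  · exact (hη (s u)).trans (hs u)
  · exact (hθ (t u)).trans (ht u)
  · have e : ∀ f : P → QFiliform d →ₗ⁅ℂ⁆ N,
        ∑ q, f q ((Pi.single p a : P → QFiliform d) q) = f p a := fun f => by
      rw [Finset.sum_eq_single p]
      · rw [Pi.single_eq_same]
      · intro q _ hq
        rw [Pi.single_eq_of_ne hq, map_zero]
      · simp
    have := hθ (Pi.single p a)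
    rw [e, e] at this
    exact this

end IsCover

end QFiliform

/-! ### Uniqueness of the decomposition -/

namespace QFiliform

variable {d : ℕ} {N : Type*} [LieRing N] [LieAlgebra ℂ N] {P : Type*}

/-- Each piece thus contains a copy of $Q_n$, which determines the central line of the piece. -/
theorem pos_of_isQuasiQFiliform_one (hd : 2 ≤ d) {m : ℕ} (h : IsQuasiQFiliform d m 1 N) :
    0 < m := by
  rcases Nat.eq_zero_or_pos m with rfl | hm
  · obtain ⟨f, hf⟩ := exists_isCover_of_isQuasiQFiliform h
    have h1 : Module.finrank ℂ (LieModule.lowerCentralSeries ℂ N N (2 * d)).toSubmodule = 1 := h.2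
    rw [hf.lowerCentralSeries_eq_span hd, Set.range_eq_empty, Submodule.span_empty,
      finrank_bot] at h1
    exact absurd h1 zero_ne_one
  · exact hm

/-- A decomposition is the grouping by central lines of a cover by copies of `Q_n`. -/
theorem exists_isCover_of_isQFiliformDecomposition {m q : ℕ} {mult : Fin q → ℕ}
    {S : Fin q → LieSubalgebra ℂ N} (h : IsQFiliformDecomposition d m mult S) :
    ∃ f : (Σ i, Fin (mult i)) → QFiliform d →ₗ⁅ℂ⁆ N, IsCover f ∧
      (∀ i, (S i).toSubmodule = ⨆ k, (f ⟨i, k⟩).range.toSubmodule) ∧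
      ∀ p p', centralLine f p = centralLine f p' ↔ p.1 = p'.1 := by
  choose g hg using fun i => exists_isCover_of_isQuasiQFiliform (h.quasi i)
  let f : (Σ i, Fin (mult i)) → QFiliform d →ₗ⁅ℂ⁆ N := fun p => (S p.1).incl.comp (g p.1 p.2)
  have hS : ∀ i, (S i).toSubmodule = ⨆ k, (f ⟨i, k⟩).range.toSubmodule := fun i => by
    apply le_antisymm
    · intro u hu
      obtain ⟨a, ha⟩ := (hg i).exists_sum_eq ⟨u, hu⟩
      refine (mem_iSup_range_iff fun k => f ⟨i, k⟩).2 ⟨a, ?_⟩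
      have := congrArg Subtype.val ha
      rwa [AddSubmonoidClass.coe_finsetSum] at this
    · refine iSup_le fun k => ?_
      rintro _ ⟨a, rfl⟩
      exact (g i k a).2
  have hf : IsCover f := by
    refine ⟨fun p => Subtype.val_injective.comp ((hg p.1).injective p.2), ?_, ?_⟩
    · rintro ⟨i, k⟩ ⟨j, l⟩ hne a b
      by_cases hij : i = j
      · subst hij
        exact congrArg Subtype.val
          ((hg i).comm k l (fun hkl => hne (congrArg (Sigma.mk i) hkl)) a b)
      · exact h.comm i j hij _ (g i k a).2 _ (g j l b).2
    · rw [iSup_sigma, ← h.sum]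
      exact iSup_congr fun i => (hS i).symm
  refine ⟨f, hf, hS, ?_⟩
  rintro ⟨i, k⟩ ⟨j, l⟩
  refine ⟨fun hl => ?_, ?_⟩
  · by_contra hij
    have hmem := (hf.mem_centralLine_iff _ _).2 hl
    obtain ⟨c, hc⟩ := Submodule.mem_span_singleton.1 hmem
    refine hf.apply_x_top_ne_zero ⟨i, k⟩
      ((LieSubalgebra.eq_bot_iff _).1 (h.inter i j hij) _ ((LieSubalgebra.mem_inf _ _ _).2 ⟨?_, ?_⟩))
    · exact (g i k _).2
    · rw [← hc]
      exact (S j).smul_mem c (g j l _).2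
  -- Inside one piece $c^{n-1}$ is a line, so all its copies share it.
  · rintro (rfl : i = j)
    obtain ⟨c, hc⟩ := Submodule.mem_span_singleton.1
      ((hg i).mem_span_of_finrank_eq_one (h.quasi i).2 k l)
    exact (hf.mem_centralLine_iff _ _).1
      (Submodule.mem_span_singleton.2 ⟨c, congrArg Subtype.val hc⟩)

theorem IsCover.centralLine_le_transporter [Fintype P] {f : P → QFiliform d →ₗ⁅ℂ⁆ N}
    (hf : IsCover f) (p : P) : centralLine f p ≤ transporter ⊥ :=
  (Submodule.span_singleton_le_iff_mem _ _).2 (hf.apply_x_top_mem_transporter _ p)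

/-- The number of copies of `Q_n` with a given central line does not depend on the cover. -/
theorem IsCover.card_centralLine_eq {P' : Type*} [Fintype P] [Fintype P']
    {f : P → QFiliform d →ₗ⁅ℂ⁆ N} {f' : P' → QFiliform d →ₗ⁅ℂ⁆ N} (hf : IsCover f)
    (hf' : IsCover f') (hd : 2 ≤ d) (p : P) :
    Nat.card {p' // centralLine f' p' = centralLine f p} =
      Nat.card {p' // centralLine f p' = centralLine f p} := by
  -- The transporter of the line is defined without reference to a cover, so both counts give its
  -- dimension.
  have h := hf.finrank_transporter hd (hf.centralLine_le_transporter p)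
  rw [hf'.finrank_transporter hd (hf.centralLine_le_transporter p)] at h
  have e := Nat.add_left_cancel h
  have e1 : ∀ p', f' p' (x d (2 * d + 1)) ∈ centralLine f p ↔
      centralLine f' p' = centralLine f p := fun p' =>
    ⟨fun h => span_singleton_eq_of_mem (hf'.apply_x_top_ne_zero p') h,
      fun h => h ▸ apply_x_top_mem_centralLine f' p'⟩
  simpa only [e1, hf.mem_centralLine_iff] using e

theorem IsCover.exists_centralLine_eq {P' : Type*} [Fintype P] [Fintype P']
    {f : P → QFiliform d →ₗ⁅ℂ⁆ N} {f' : P' → QFiliform d →ₗ⁅ℂ⁆ N} (hf : IsCover f)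
    (hf' : IsCover f') (hd : 2 ≤ d) (p : P) : ∃ p', centralLine f' p' = centralLine f p := by
  have h := hf.card_centralLine_eq hf' hd p
  have : Nonempty {p' // centralLine f p' = centralLine f p} := ⟨⟨p, rfl⟩⟩
  have hpos := Nat.card_pos (α := {p' // centralLine f p' = centralLine f p})
  rw [← h] at hpos
  obtain ⟨⟨p', hp'⟩⟩ := (Nat.card_pos_iff.1 hpos).1
  exact ⟨p', hp'⟩

theorem card_sigma_fst_eq {q : ℕ} {mult : Fin q → ℕ} (i : Fin q) :
    Nat.card {p : Σ i, Fin (mult i) // p.1 = i} = mult i := by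
  rw [Nat.card_congr (Equiv.sigmaSubtype i), Nat.card_eq_fintype_card, Fintype.card_fin]

/-- Rescaling one of two covers with the same central lines identifies their central vectors. -/
theorem IsCover.exists_lieEquiv_of_centralLine_eq [Fintype P] {f g : P → QFiliform d →ₗ⁅ℂ⁆ N}
    (hf : IsCover f) (hg : IsCover g) (hd : 2 ≤ d)
    (h : ∀ p, centralLine g p = centralLine f p) :
    ∃ θ : N ≃ₗ⁅ℂ⁆ N, ∀ p, (f p).range.toSubmodule.map (θ.toLieHom : N →ₗ[ℂ] N) =
      (g p).range.toSubmodule := by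
  have hscale : ∀ p, ∃ t : ℂ, t ≠ 0 ∧
      f p (x d (2 * d + 1)) = g p (dilation d t (x d (2 * d + 1))) := fun p => by
    have hmem : f p (x d (2 * d + 1)) ∈ centralLine g p :=
      h p ▸ apply_x_top_mem_centralLine f p
    obtain ⟨c, hc⟩ := Submodule.mem_span_singleton.1 hmem
    -- An $n$-th root is needed because the dilation by `t` multiplies $x_n$ by $t^n$.
    obtain ⟨t, ht⟩ := IsAlgClosed.exists_pow_nat_eq c (n := 2 * d + 1) (by omega)
    refine ⟨t, fun h0 => hf.apply_x_top_ne_zero p ?_, ?_⟩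
    · rw [← hc, ← ht, h0, zero_pow (by omega), zero_smul]
    · rw [dilation_x_top, map_smul, ht, hc]
  choose t ht0 ht using hscale
  -- A dilation with `t p ≠ 0` is bijective, so rescaling keeps each copy as a subalgebra.
  have hrange : ∀ p, ((g p).comp (dilation d (t p))).range.toSubmodule =
      (g p).range.toSubmodule := fun p => by
    apply le_antisymm
    · rintro _ ⟨a, rfl⟩
      exact ⟨dilation d (t p) a, rfl⟩
    · rintro _ ⟨a, rfl⟩
      exact ⟨dilation d (t p)⁻¹ a, congrArg (g p) (dilation_dilation_inv (ht0 p) a)⟩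
  have hg' : IsCover fun p => (g p).comp (dilation d (t p)) :=
    ⟨fun p => (hg.injective p).comp (dilation_injective (ht0 p)),
      fun p p' hne a b => hg.comm p p' hne _ _, by simp only [hrange, hg.iSup_range]⟩
  obtain ⟨θ, hθ⟩ := hf.exists_lieEquiv hg' hd ht
  refine ⟨θ, fun p => ?_⟩
  rw [← hrange]
  ext u
  constructor
  · rintro ⟨_, ⟨a, rfl⟩, rfl⟩
    exact ⟨a, (hθ p a).symm⟩
  · rintro ⟨a, rfl⟩
    exact ⟨_, ⟨a, rfl⟩, hθ p a⟩

theorem exists_lieEquiv_of_isQFiliformDecomposition (hd : 2 ≤ d) {m m' q q' : ℕ}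
    {mult : Fin q → ℕ} {mult' : Fin q' → ℕ} {S : Fin q → LieSubalgebra ℂ N}
    {S' : Fin q' → LieSubalgebra ℂ N} (h : IsQFiliformDecomposition d m mult S)
    (h' : IsQFiliformDecomposition d m' mult' S') :
    ∃ (σ : Fin q ≃ Fin q') (θ : N ≃ₗ⁅ℂ⁆ N),
      ∀ i, mult' (σ i) = mult i ∧ (S i).map θ.toLieHom = S' (σ i) := by
  obtain ⟨f, hf, hS, hline⟩ := exists_isCover_of_isQFiliformDecomposition h
  obtain ⟨f', hf', hS', hline'⟩ := exists_isCover_of_isQFiliformDecomposition h'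
  let b : ∀ i, Σ i, Fin (mult i) := fun i => ⟨i, 0, pos_of_isQuasiQFiliform_one hd (h.quasi i)⟩
  let b' : ∀ i, Σ i, Fin (mult' i) :=
    fun i => ⟨i, 0, pos_of_isQuasiQFiliform_one hd (h'.quasi i)⟩
  have hex : ∀ i, ∃ j, centralLine f' (b' j) = centralLine f (b i) := fun i => by
    obtain ⟨p, hp⟩ := hf.exists_centralLine_eq hf' hd (b i)
    exact ⟨p.1, ((hline' (b' p.1) p).2 rfl).trans hp⟩
  choose s hs using hex
  have hbij : Function.Bijective s := by
    refine ⟨fun i j hij => ?_, fun j => ?_⟩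
    · exact (hline (b i) (b j)).1 ((hs i).symm.trans (hij ▸ hs j))
    · obtain ⟨p, hp⟩ := hf'.exists_centralLine_eq hf hd (b' j)
      refine ⟨p.1, (hline' (b' _) (b' j)).1 ((hs p.1).trans (Eq.trans ?_ hp))⟩
      exact (hline _ _).2 rfl
  have hmult : ∀ i, mult' (s i) = mult i := fun i => by
    have e := hf.card_centralLine_eq hf' hd (b i)
    rw [← hs i] at e
    simp only [hline'] at e
    simp only [hs i, hline] at e
    exact (card_sigma_fst_eq (s i)).symm.trans (e.trans (card_sigma_fst_eq i))
  let σ : Fin q ≃ Fin q' := Equiv.ofBijective s hbij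
  -- Since the multiplicities agree, the copies in matched pieces can be paired off, and pairs share
  -- a central line.
  let e : (Σ i, Fin (mult i)) ≃ Σ j, Fin (mult' j) :=
    Equiv.sigmaCongr σ fun i => finCongr (hmult i).symm
  have hg : IsCover fun p => f' (e p) :=
    ⟨fun p => hf'.injective _, hf'.comm.comp e.injective, by
      rw [← hf'.iSup_range]
      exact e.iSup_comp (g := fun p => (f' p).range.toSubmodule)⟩
  obtain ⟨θ, hθ⟩ := hf.exists_lieEquiv_of_centralLine_eq hg hd fun p =>
    ((hline' (e p) (b' (s p.1))).2 rfl).trans ((hs p.1).trans ((hline _ _).2 rfl))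
  refine ⟨σ, θ, fun i => ⟨hmult i, LieSubalgebra.toSubmodule_injective ?_⟩⟩
  change (S i).toSubmodule.map (θ.toLieHom : N →ₗ[ℂ] N) = _
  rw [hS, hS', Submodule.map_iSup]
  simp only [hθ]
  exact (finCongr (hmult i).symm).iSup_comp
    (g := fun k => (f' ⟨σ i, k⟩).range.toSubmodule)

end QFiliform

theorem proposition2p1 (d : ℕ) (hd : 2 ≤ d) (m r : ℕ)
    {N : Type*} [LieRing N] [LieAlgebra ℂ N] (hN : IsQuasiQFiliform d m r N) :
    (∃ (q : ℕ) (mult : Fin q → ℕ) (S : Fin q → LieSubalgebra ℂ N),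
      IsQFiliformDecomposition d m mult S) ∧
    ∀ (q q' : ℕ) (mult : Fin q → ℕ) (mult' : Fin q' → ℕ)
      (S : Fin q → LieSubalgebra ℂ N) (S' : Fin q' → LieSubalgebra ℂ N),
      IsQFiliformDecomposition d m mult S → IsQFiliformDecomposition d m mult' S' →
      ∃ (σ : Fin q ≃ Fin q') (θ : N ≃ₗ⁅ℂ⁆ N),
        ∀ i, mult' (σ i) = mult i ∧ (S i).map θ.toLieHom = S' (σ i) :=
  ⟨QFiliform.exists_isQFiliformDecomposition hd hN, fun _ _ _ _ _ _ h h' =>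
    QFiliform.exists_lieEquiv_of_isQFiliformDecomposition hd h h'⟩
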